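/- Let $d,n_1,n_2\ge 0$ be integers, $\kappa_1,\dots,\kappa_{n_1}\in\mathbb R$ with $\kappa_i^2>0$, $\alpha_1,\dots,\alpha_{n_1}\in\mathbb N$, $b_1,\dots,b_{n_2}\in\mathbb R$, $\mathbf B_1,\dots,\mathbf B_{n_2}\in\mathbb R^d$ and $\phi\in\mathbb R$. A (second-order, generalized) random field on $\mathbb R^d$ is a continuous linear map $f\mapsto X(f)=\text{``}\int f(\mathbf s)X(\mathbf s)\,d\mathbf s\text{''}$ from the Schwartz functions on $\mathbb R^d$ to the square-integrable random variables of a probability space. Let $\mathcal W$ be Gaussian white noise (for real $f$, $\mathcal W(f)$ is a centred real Gaussian variable with variance $\int f^2$), and let the random field $X$ solve $$\Bigl(\prod_{i=1}^{n_1}(\kappa_i^2-\Delta)^{\alpha_i/2}\Bigr)X=\Bigl(\prod_{j=1}^{n_2}(b_j+\mathbf B_j^{\top}\nabla)\Bigr)\phi\,\mathcal W$$ in the sense of tempered distributions, where $(\kappa^2-\Delta)^{\alpha/2}$ is the Fourier multiplier with symbol $(\kappa^2+\|\mathbf k\|^2)^{\alpha/2}$. Then $X$ is wide-sense stationary with spectral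 density $$S(\mathbf k)=\frac{\phi^2}{(2\pi)^d}\,\frac{\prod_{j=1}^{n_2}(b_j^2+\mathbf k^{\top}\mathbf B_j\mathbf B_j^{\top}\mathbf k)}{\prod_{j=1}^{n_1}(\kappa_j^2+\|\mathbf k\|^2)^{\alpha_j}}.$$ That is, the mean of $X$ is constant and, for all Schwartz functions $f,g$, $$\operatorname{Cov}(X(f),X(g))=\int_{\mathbb R^d}\hat f(\mathbf k)\,\overline{\hat g(\mathbf k)}\,S(\mathbf k)\,d\mathbf k,\qquad \hat f(\mathbf k)=\int_{\mathbb R^d} e^{i\mathbf k^{\top}\mathbf s}f(\mathbf s)\,d\mathbf s,$$ with an absolutely convergent integral. If moreover $X$ is represented by an ordinary mean-square continuous field $X(\mathbf s)$, $\mathbf s\in\mathbb R^d$, that is, $X(f)=\int f(\mathbf s)X(\mathbf s)\,d\mathbf s$ for all compactly supported smooth $f$, then $S$ is integrable, $X(\mathbf s)$ has constant mean, and $\operatorname{Cov}(X(\mathbf s),X(\mathbf t))=\int_{\mathbb R^d} e^{i\mathbf k^{\top}(\mathbf s-\mathbf t)}S(\mathbf k)\,d\mathbf k$ for all $\mathbf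 s,\mathbf t\in\mathbb R^d$. -/

import Mathlib

open MeasureTheory ProbabilityTheory FourierTransform
open scoped SchwartzMap LineDeriv

noncomputable section

namespace NestedSPDE

/-- The space `ℝ^d` with its Euclidean structure. -/
abbrev Space (d : ℕ) : Type := EuclideanSpace ℝ (Fin d)

/-- Second-order generalized random fields on `ℝ^d` over the probability space `(Ω, P)`:
continuous linear maps from Schwartz test functions to square-integrable random variables,
that is, `L²(P)`-valued tempered distributions. An ordinary field `s ↦ X(s)` acts by
`f ↦ ∫ f(s) X(s) ds`. -/
abbrev RandomField (d : ℕ) {Ω : Type*} [MeasurableSpace Ω] (P : Measure Ω) : Type _ :=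
  𝓢'(Space d, Lp ℂ 2 P)

section Operators

variable {d : ℕ} {F : Type*} [NormedAddCommGroup F] [NormedSpace ℂ F]

variable (d F) in
/-- The operator `(κ² - Δ)^(α/2)` on tempered distributions: the Fourier multiplier with symbol
`(κ² + ‖k‖²)^(α/2)`, `k` the angular frequency. Mathlib's Fourier transform uses `exp(-2πi⟨s, ξ⟩)`,
so that `k = 2πξ`. -/
def maternOp (κ : ℝ) (α : ℕ) : 𝓢'(Space d, F) →L[ℂ] 𝓢'(Space d, F) :=
  TemperedDistribution.fourierMultiplierCLM F
    (fun ξ ↦ (((κ ^ 2 + ‖(2 * Real.pi) • ξ‖ ^ 2) ^ ((α : ℝ) / 2) : ℝ) : ℂ))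

variable (F) in
/-- The operator `b + Bᵀ∇` on tempered distributions. -/
def gradOp (b : ℝ) (B : Space d) : 𝓢'(Space d, F) →L[ℂ] 𝓢'(Space d, F) :=
  (b : ℂ) • ContinuousLinearMap.id ℂ 𝓢'(Space d, F) +
    LineDeriv.lineDerivOpCLM ℂ 𝓢'(Space d, F) B

variable (d F) in
/-- `ℒ₁ = ∏ᵢ (κᵢ² - Δ)^(αᵢ/2)`, the product being composition of operators. -/
def opL₁ {n₁ : ℕ} (κ : Fin n₁ → ℝ) (α : Fin n₁ → ℕ) :
    𝓢'(Space d, F) →L[ℂ] 𝓢'(Space d, F) :=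
  (List.ofFn fun i ↦ maternOp d F (κ i) (α i)).prod

variable (F) in
/-- `ℒ₂ = ∏ⱼ (bⱼ + Bⱼᵀ∇)`, the product being composition of operators. -/
def opL₂ {n₂ : ℕ} (b : Fin n₂ → ℝ) (B : Fin n₂ → Space d) :
    𝓢'(Space d, F) →L[ℂ] 𝓢'(Space d, F) :=
  (List.ofFn fun j ↦ gradOp F (b j) (B j)).prod

end Operators

section RandomFields

variable {d : ℕ} {Ω : Type*} [MeasurableSpace Ω] {P : Measure Ω}

/-- Gaussian white noise on `ℝ^d`: on every real test function `f` it is a real centred Gaussian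
variable with variance `∫ f²` (joint Gaussianity and the covariance `∫ f g` follow by linearity). -/
def IsGaussianWhiteNoise (W : RandomField d P) : Prop :=
  ∀ f : 𝓢(Space d, ℂ), (∀ x, (f x).im = 0) →
    HasLaw (fun ω ↦ W f ω)
      ((gaussianReal 0 (Real.toNNReal (∫ x, (f x).re ^ 2))).map (fun x : ℝ ↦ (x : ℂ))) P

/-- Covariance `E[(U - EU) conj(V - EV)]` of square-integrable complex random variables. -/
def covar (U V : Lp ℂ 2 P) : ℂ :=
  ∫ ω, (U ω - ∫ ω', U ω' ∂P) * (starRingEnd ℂ) (V ω - ∫ ω', V ω' ∂P) ∂P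

/-- `∫ exp(i kᵀs) f(s) ds`. -/
def angularTransform (f : 𝓢(Space d, ℂ)) (k : Space d) : ℂ :=
  ∫ s, Complex.exp (Complex.I * (inner ℝ k s : ℝ)) * f s

/-- The generalized random field `X` is wide-sense stationary with spectral density `S`: its mean is
a constant function, and formally `Cov(X(s), X(t)) = ∫ exp(i kᵀ(s-t)) S(k) dk`, that is,
`Cov(X(f), X(g)) = ∫ (∫ exp(i kᵀs) f(s) ds) conj(∫ exp(i kᵀt) g(t) dt) S(k) dk` for all test
functions, the integral over `k` converging absolutely. -/
def HasSpectralDensity (X : RandomField d P) (S : Space d → ℝ) : Prop :=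
  Measurable S ∧ (∀ k, 0 ≤ S k) ∧
  (∃ m : ℂ, ∀ f : 𝓢(Space d, ℂ), ∫ ω, X f ω ∂P = m * ∫ s, f s) ∧
  ∀ f g : 𝓢(Space d, ℂ),
    Integrable (fun k ↦ angularTransform f k * (starRingEnd ℂ) (angularTransform g k) * (S k : ℂ)) ∧
    covar (X f) (X g) =
      ∫ k, angularTransform f k * (starRingEnd ℂ) (angularTransform g k) * (S k : ℂ)

/-- The ordinary mean-square continuous field `s ↦ Y(s)` represents the generalized field `X`:
`X(f) = ∫ f(s) Y(s) ds` for all compactly supported test functions `f`. -/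
def IsRepresentedBy (X : RandomField d P) (Y : Space d → Lp ℂ 2 P) : Prop :=
  Continuous Y ∧
  ∀ f : 𝓢(Space d, ℂ), HasCompactSupport (f : Space d → ℂ) → X f = ∫ s, f s • Y s

/-- The ordinary field `Y` is wide-sense stationary with (integrable) spectral density `S`: its mean
is constant and `Cov(Y(s), Y(t)) = ∫ exp(i kᵀ(s-t)) S(k) dk`. -/
def HasPointwiseSpectralDensity (Y : Space d → Lp ℂ 2 P) (S : Space d → ℝ) : Prop :=
  Integrable S ∧ (∀ k, 0 ≤ S k) ∧
  (∃ m : ℂ, ∀ s, ∫ ω, Y s ω ∂P = m) ∧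
  ∀ s t, covar (Y s) (Y t) =
    ∫ k, Complex.exp (Complex.I * (inner ℝ k (s - t) : ℝ)) * (S k : ℂ)

end RandomFields

end NestedSPDE

end

/-!
A Fourier multiplier with symbol `a` acts on test functions by multiplying their transforms by `a`,
so it multiplies the spectral density of a random field by `|a|²`. Gaussian white noise has a flat
spectral density by Plancherel, each factor of `ℒ₂` multiplies it by the squared modulus of its
symbol, and each factor of `ℒ₁`, being invertible, divides it.

If the solution is an ordinary mean-square continuous field, testing it against mollifiers at `s`
and `t` recovers the values there. The transforms of the mollifiers are bounded by `1` and converge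
to exponentials, so Fatou's lemma gives integrability of `S` and dominated convergence the
covariance.
-/

noncomputable section

namespace NestedSPDE

section AngularMultiplier

theorem hasTemperateGrowth_comp_two_pi_smul {E : Type*} [NormedAddCommGroup E] [NormedSpace ℝ E]
    {a : E → ℂ} (ha : a.HasTemperateGrowth) :
    (fun ξ ↦ a ((2 * Real.pi) • ξ)).HasTemperateGrowth :=
  ha.comp ((2 * Real.pi) • ContinuousLinearMap.id ℝ E).hasTemperateGrowth

variable {E F : Type*} [NormedAddCommGroup E] [InnerProductSpace ℝ E] [FiniteDimensional ℝ E]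
  [MeasurableSpace E] [BorelSpace E] [NormedAddCommGroup F] [NormedSpace ℂ F]

variable (F) in
/-- The operator `a(-i∇)` on tempered distributions, that is, the Fourier multiplier whose symbol
`a` is a function of the angular frequency `k = 2πξ`. -/
def angularMultiplier (a : E → ℂ) : 𝓢'(E, F) →L[ℂ] 𝓢'(E, F) :=
  TemperedDistribution.fourierMultiplierCLM F fun ξ ↦ a ((2 * Real.pi) • ξ)

theorem angularMultiplier_const (c : ℂ) (X : 𝓢'(E, F)) :
    angularMultiplier F (fun _ ↦ c) X = c • X := by
  simp [angularMultiplier]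

theorem angularMultiplier_inv_angularMultiplier {a : E → ℂ} (ha : a.HasTemperateGrowth)
    (ha_inv : a⁻¹.HasTemperateGrowth) (ha_ne : ∀ k, a k ≠ 0) (X : 𝓢'(E, F)) :
    angularMultiplier F a⁻¹ (angularMultiplier F a X) = X := by
  have h_one : ((fun ξ ↦ a ((2 * Real.pi) • ξ)) * fun ξ ↦ a⁻¹ ((2 * Real.pi) • ξ)) =
      fun _ ↦ 1 :=
    funext fun ξ ↦ mul_inv_cancel₀ (ha_ne _)
  rw [angularMultiplier, angularMultiplier,
    TemperedDistribution.fourierMultiplierCLM_fourierMultiplierCLM_apply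
      (hasTemperateGrowth_comp_two_pi_smul ha) (hasTemperateGrowth_comp_two_pi_smul ha_inv),
    h_one, TemperedDistribution.fourierMultiplierCLM_const, one_smul, ContinuousLinearMap.id_apply]

end AngularMultiplier

section Operators

variable {d : ℕ} {F : Type*} [NormedAddCommGroup F] [NormedSpace ℂ F]

/-- The symbol `b + i Bᵀk` of `b + Bᵀ∇`. -/
def gradSymbol (b : ℝ) (B k : Space d) : ℂ :=
  b + (inner ℝ k B : ℝ) * Complex.I

theorem hasTemperateGrowth_gradSymbol (b : ℝ) (B : Space d) :
    (gradSymbol b B).HasTemperateGrowth := by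
  unfold gradSymbol
  fun_prop

theorem norm_gradSymbol_sq (b : ℝ) (B k : Space d) :
    ‖gradSymbol b B k‖ ^ 2 = b ^ 2 + inner ℝ k B ^ 2 := by
  rw [gradSymbol, ← Complex.normSq_eq_norm_sq, Complex.normSq_add_mul_I]

theorem gradOp_eq_angularMultiplier (b : ℝ) (B : Space d) :
    gradOp F b B = angularMultiplier F (gradSymbol b B) := by
  have h_symbol : (fun ξ ↦ gradSymbol b B ((2 * Real.pi) • ξ)) =
      (fun _ ↦ (b : ℂ)) + (2 * Real.pi * Complex.I) • fun ξ ↦ ((inner ℝ ξ B : ℝ) : ℂ) := by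
    ext ξ
    simp only [gradSymbol, real_inner_smul_left, Pi.add_apply, Pi.smul_apply, smul_eq_mul]
    push_cast
    ring
  ext X f
  rw [angularMultiplier, h_symbol, TemperedDistribution.fourierMultiplierCLM_apply_apply,
    SchwartzMap.smulLeftCLM_add (by fun_prop) (by fun_prop),
    SchwartzMap.smulLeftCLM_smul (by fun_prop)]
  simp [gradOp, TemperedDistribution.lineDeriv_eq_fourierMultiplierCLM, -Complex.coe_smul]

/-- The symbol `(κ² + ‖k‖²)^r` of `(κ² - Δ)^r`. -/
def maternSymbol {E : Type*} [NormedAddCommGroup E] (κ r : ℝ) (k : E) : ℂ :=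
  ((κ ^ 2 + ‖k‖ ^ 2) ^ r : ℝ)

section Matern

variable {E : Type*} [NormedAddCommGroup E] {κ : ℝ}

theorem maternSymbol_ne_zero (hκ : κ ≠ 0) (r : ℝ) (k : E) : maternSymbol κ r k ≠ 0 :=
  Complex.ofReal_ne_zero.2 (Real.rpow_pos_of_pos (by positivity) r).ne'

theorem inv_maternSymbol (κ r : ℝ) :
    (maternSymbol κ r)⁻¹ = (maternSymbol κ (-r) : E → ℂ) := by
  ext k
  rw [Pi.inv_apply, maternSymbol, maternSymbol, Real.rpow_neg (by positivity), Complex.ofReal_inv]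

theorem norm_maternSymbol_sq (κ r : ℝ) (k : E) :
    ‖maternSymbol κ r k‖ ^ 2 = (κ ^ 2 + ‖k‖ ^ 2) ^ (2 * r) := by
  rw [maternSymbol, Complex.norm_real, Real.norm_eq_abs, sq_abs, mul_comm 2 r,
    Real.rpow_mul (by positivity), Real.rpow_two]

theorem hasTemperateGrowth_maternSymbol [InnerProductSpace ℝ E] (hκ : κ ≠ 0) (r : ℝ) :
    (maternSymbol κ r : E → ℂ).HasTemperateGrowth := by
  have h_scale : maternSymbol κ r = fun k : E ↦
      (((κ ^ 2) ^ r * (1 + ‖(κ⁻¹ • ContinuousLinearMap.id ℝ E) k‖ ^ 2) ^ r : ℝ) : ℂ) := by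
    ext k
    rw [maternSymbol, ← Real.mul_rpow (by positivity) (by positivity)]
    simp [norm_smul, mul_pow, mul_add, hκ]
  rw [h_scale]
  exact Function.Complex.hasTemperateGrowth_ofReal.comp
    ((Function.HasTemperateGrowth.const _).mul
      ((Function.hasTemperateGrowth_one_add_norm_sq_rpow E r).comp
        (ContinuousLinearMap.hasTemperateGrowth _)))

end Matern

variable (d F) in
/-- The operator `(κ² - Δ)^(α/2)` of real order `α`; for `α : ℕ` it is `maternOp`. -/
def fracMaternOp (κ α : ℝ) : 𝓢'(Space d, F) →L[ℂ] 𝓢'(Space d, F) :=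
  angularMultiplier F (maternSymbol κ (α / 2))

variable (d F) in
/-- `∏ᵢ (κᵢ² - Δ)^(αᵢ/2)` with real orders `αᵢ`; for `αᵢ : ℕ` it is `opL₁`. -/
def fracOpL₁ {n : ℕ} (κ α : Fin n → ℝ) : 𝓢'(Space d, F) →L[ℂ] 𝓢'(Space d, F) :=
  (List.ofFn fun i ↦ fracMaternOp d F (κ i) (α i)).prod

theorem fracOpL₁_natCast {n : ℕ} (κ : Fin n → ℝ) (α : Fin n → ℕ) :
    fracOpL₁ d F κ (fun i ↦ α i) = opL₁ d F κ α :=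
  rfl

end Operators

section AngularTransform

variable {d : ℕ}

theorem angularTransform_eq_fourierInv (f : 𝓢(Space d, ℂ)) (k : Space d) :
    angularTransform f k = 𝓕⁻ f ((2 * Real.pi)⁻¹ • k) := by
  rw [SchwartzMap.fourierInv_coe, Real.fourierInv_eq', angularTransform]
  congr with s
  rw [real_inner_smul_right, mul_inv_cancel_left₀ Real.two_pi_pos.ne', real_inner_comm,
    mul_comm Complex.I, smul_eq_mul]

theorem angularTransform_zero (f : 𝓢(Space d, ℂ)) : angularTransform f 0 = ∫ s, f s := by
  simp [angularTransform]

theorem angularTransform_fourier_smulLeftCLM_fourierInv {a : Space d → ℂ}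
    (ha : a.HasTemperateGrowth) (f : 𝓢(Space d, ℂ)) (k : Space d) :
    angularTransform (𝓕 (SchwartzMap.smulLeftCLM ℂ (fun ξ ↦ a ((2 * Real.pi) • ξ)) (𝓕⁻ f))) k =
      a k * angularTransform f k := by
  rw [angularTransform_eq_fourierInv, FourierTransform.fourierInv_fourier_eq,
    SchwartzMap.smulLeftCLM_apply_apply (hasTemperateGrowth_comp_two_pi_smul ha),
    smul_inv_smul₀ Real.two_pi_pos.ne', smul_eq_mul, angularTransform_eq_fourierInv]

theorem integrable_mul_conj (f g : 𝓢(Space d, ℂ)) :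
    Integrable fun s ↦ f s * (starRingEnd ℂ) (g s) :=
  (f.memLp 2).integrable_mul (g.memLp 2).star

theorem integrable_angularTransform_mul_conj (f g : 𝓢(Space d, ℂ)) :
    Integrable fun k ↦ angularTransform f k * (starRingEnd ℂ) (angularTransform g k) := by
  simp only [angularTransform_eq_fourierInv]
  exact (integrable_mul_conj (𝓕⁻ f) (𝓕⁻ g)).comp_smul (by positivity)

theorem integral_angularTransform_mul_conj (f g : 𝓢(Space d, ℂ)) :
    ∫ k, angularTransform f k * (starRingEnd ℂ) (angularTransform g k) =
      (2 * Real.pi) ^ d * ∫ s, f s * (starRingEnd ℂ) (g s) := by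
  have h_plancherel := SchwartzMap.integral_inner_fourier_fourier (𝓕⁻ g) (𝓕⁻ f)
  simp only [FourierTransform.fourier_fourierInv_eq, RCLike.inner_apply] at h_plancherel
  simp only [angularTransform_eq_fourierInv]
  rw [Measure.integral_comp_inv_smul_of_nonneg volume
    (fun ξ ↦ 𝓕⁻ f ξ * (starRingEnd ℂ) (𝓕⁻ g ξ)) Real.two_pi_pos.le, h_plancherel,
    finrank_euclideanSpace_fin, Complex.real_smul]
  push_cast
  rfl

end AngularTransform

section Filtering

variable {d : ℕ} {Ω : Type*} [MeasurableSpace Ω] {P : Measure Ω} {X : RandomField d P}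
  {S : Space d → ℝ}

theorem HasSpectralDensity.map_angularMultiplier (hX : HasSpectralDensity X S) {a : Space d → ℂ}
    (ha : a.HasTemperateGrowth) :
    HasSpectralDensity (angularMultiplier _ a X) fun k ↦ ‖a k‖ ^ 2 * S k := by
  obtain ⟨hS_meas, hS_nonneg, ⟨m, hm⟩, h_covar⟩ := hX
  let A (f : 𝓢(Space d, ℂ)) : 𝓢(Space d, ℂ) :=
    𝓕 (SchwartzMap.smulLeftCLM ℂ (fun ξ ↦ a ((2 * Real.pi) • ξ)) (𝓕⁻ f))
  have hA f k : angularTransform (A f) k = a k * angularTransform f k :=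
    angularTransform_fourier_smulLeftCLM_fourierInv ha f k
  have h_integrand f g k :
      angularTransform f k * (starRingEnd ℂ) (angularTransform g k) * (‖a k‖ ^ 2 * S k : ℝ) =
        angularTransform (A f) k * (starRingEnd ℂ) (angularTransform (A g) k) * (S k : ℂ) := by
    rw [hA, hA, map_mul, Complex.ofReal_mul, Complex.ofReal_pow, ← Complex.mul_conj']
    ring
  refine ⟨(ha.1.continuous.norm.pow 2).measurable.mul hS_meas,
    fun k ↦ mul_nonneg (sq_nonneg _) (hS_nonneg k), ⟨m * a 0, fun f ↦ ?_⟩, fun f g ↦ ?_⟩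
  · exact (hm (A f)).trans (by
      rw [← angularTransform_zero, hA, angularTransform_zero, mul_assoc])
  · simp only [h_integrand]
    exact h_covar (A f) (A g)

theorem HasSpectralDensity.const_smul (hX : HasSpectralDensity X S) (c : ℂ) :
    HasSpectralDensity (c • X) fun k ↦ ‖c‖ ^ 2 * S k := by
  rw [← angularMultiplier_const]
  exact hX.map_angularMultiplier (.const c)

theorem HasSpectralDensity.of_angularMultiplier {a : Space d → ℂ} (ha : a.HasTemperateGrowth)
    (ha_inv : a⁻¹.HasTemperateGrowth) (ha_ne : ∀ k, a k ≠ 0)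
    (hX : HasSpectralDensity (angularMultiplier _ a X) S) :
    HasSpectralDensity X fun k ↦ S k / ‖a k‖ ^ 2 := by
  have h := hX.map_angularMultiplier ha_inv
  rw [angularMultiplier_inv_angularMultiplier ha ha_inv ha_ne] at h
  simpa only [Pi.inv_apply, norm_inv, inv_pow, inv_mul_eq_div] using h

theorem HasSpectralDensity.map_gradOp (hX : HasSpectralDensity X S) (b : ℝ) (B : Space d) :
    HasSpectralDensity (gradOp _ b B X) fun k ↦ (b ^ 2 + inner ℝ k B ^ 2) * S k := by
  rw [gradOp_eq_angularMultiplier]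
  simpa only [norm_gradSymbol_sq] using hX.map_angularMultiplier (hasTemperateGrowth_gradSymbol b B)

theorem HasSpectralDensity.map_opL₂ (hX : HasSpectralDensity X S) {n : ℕ} (b : Fin n → ℝ)
    (B : Fin n → Space d) :
    HasSpectralDensity (opL₂ _ b B X) fun k ↦ (∏ j, (b j ^ 2 + inner ℝ k (B j) ^ 2)) * S k := by
  induction n with
  | zero => simpa [opL₂] using hX
  | succ n ih =>
    have h_cons : opL₂ _ b B X = gradOp _ (b 0) (B 0)
        (opL₂ _ (fun j ↦ b j.succ) (fun j ↦ B j.succ) X) := by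
      simp [opL₂, List.ofFn_succ]
    rw [h_cons]
    simpa only [Fin.prod_univ_succ, mul_assoc] using
      (ih (fun j ↦ b j.succ) fun j ↦ B j.succ).map_gradOp (b 0) (B 0)

theorem HasSpectralDensity.of_fracMaternOp {κ : ℝ} (hκ : κ ≠ 0) {α : ℝ}
    (hX : HasSpectralDensity (fracMaternOp d _ κ α X) S) :
    HasSpectralDensity X fun k ↦ S k / (κ ^ 2 + ‖k‖ ^ 2) ^ α := by
  have h := HasSpectralDensity.of_angularMultiplier (hasTemperateGrowth_maternSymbol hκ (α / 2))
    (inv_maternSymbol (E := Space d) κ (α / 2) ▸ hasTemperateGrowth_maternSymbol hκ _)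
    (maternSymbol_ne_zero hκ _) hX
  simpa only [norm_maternSymbol_sq, mul_div_cancel₀ α two_ne_zero] using h

theorem HasSpectralDensity.of_fracOpL₁ {n : ℕ} {κ : Fin n → ℝ} (hκ : ∀ i, κ i ≠ 0)
    {α : Fin n → ℝ} (hX : HasSpectralDensity (fracOpL₁ d _ κ α X) S) :
    HasSpectralDensity X fun k ↦ S k / ∏ i, (κ i ^ 2 + ‖k‖ ^ 2) ^ α i := by
  induction n generalizing S with
  | zero => simpa [fracOpL₁] using hX
  | succ n ih =>
    have h_cons : fracOpL₁ d _ κ α X = fracMaternOp d _ (κ 0) (α 0)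
        (fracOpL₁ d _ (fun i ↦ κ i.succ) (fun i ↦ α i.succ) X) := by
      simp [fracOpL₁, List.ofFn_succ]
    rw [h_cons] at hX
    simpa only [Fin.prod_univ_succ, div_div] using
      ih (fun i ↦ hκ i.succ) (hX.of_fracMaternOp (hκ 0))

end Filtering

section SecondMoments

variable {Ω : Type*} [MeasurableSpace Ω] {P : Measure Ω}

theorem norm_sq_eq_integral_norm_sq {E : Type*} [NormedAddCommGroup E] [InnerProductSpace ℂ E]
    (U : Lp E 2 P) : ‖U‖ ^ 2 = ∫ ω, ‖U ω‖ ^ 2 ∂P := by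
  rw [← Complex.ofReal_inj, ← integral_complex_ofReal, Complex.ofReal_pow]
  refine (inner_self_eq_norm_sq_to_K (𝕜 := ℂ) U).symm.trans ?_
  rw [L2.inner_def]
  simp [inner_self_eq_norm_sq_to_K]

theorem im_inner_eq_zero_of_real {U V : Lp ℂ 2 P} (hU : ∀ᵐ ω ∂P, (U ω).im = 0)
    (hV : ∀ᵐ ω ∂P, (V ω).im = 0) : (inner ℂ U V : ℂ).im = 0 := by
  rw [← Complex.conj_eq_iff_im, inner_conj_symm, L2.inner_def, L2.inner_def]
  refine integral_congr_ae ?_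
  filter_upwards [hU, hV] with ω hUω hVω
  simp [Complex.conj_eq_iff_im.2 hUω, Complex.conj_eq_iff_im.2 hVω, mul_comm]

theorem norm_add_I_smul_sq_of_real {U V : Lp ℂ 2 P} (hU : ∀ᵐ ω ∂P, (U ω).im = 0)
    (hV : ∀ᵐ ω ∂P, (V ω).im = 0) : ‖U + Complex.I • V‖ ^ 2 = ‖U‖ ^ 2 + ‖V‖ ^ 2 := by
  rw [norm_add_sq (𝕜 := ℂ), inner_smul_right, norm_smul]
  simp [im_inner_eq_zero_of_real hU hV]

theorem covar_eq_inner_of_integral_eq_zero {U V : Lp ℂ 2 P} (hU : ∫ ω, U ω ∂P = 0)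
    (hV : ∫ ω, V ω ∂P = 0) : covar U V = inner ℂ V U := by
  simp [covar, hU, hV, L2.inner_def]

variable [IsFiniteMeasure P]

variable (P) in
/-- The expectation as a bounded linear functional on `L²(P)`. -/
def expectation : Lp ℂ 2 P →L[ℂ] ℂ :=
  innerSL ℂ (Lp.const 2 P (1 : ℂ))

theorem expectation_apply (U : Lp ℂ 2 P) : expectation P U = ∫ ω, U ω ∂P := by
  rw [expectation, innerSL_apply_apply, ← indicatorConstLp_univ, L2.inner_indicatorConstLp_one,
    setIntegral_univ]

theorem covar_eq_inner_sub_const (U V : Lp ℂ 2 P) :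
    covar U V = inner ℂ (V - Lp.constL 2 P ℂ (expectation P V))
      (U - Lp.constL 2 P ℂ (expectation P U)) := by
  have h_centred (Z : Lp ℂ 2 P) : ∀ᵐ ω ∂P,
      (Z - Lp.constL 2 P ℂ (expectation P Z) : Lp ℂ 2 P) ω = Z ω - ∫ ω', Z ω' ∂P := by
    filter_upwards [Lp.coeFn_sub Z (Lp.constL 2 P ℂ (expectation P Z)),
      Lp.coeFn_const (p := 2) (μ := P) (expectation P Z)] with ω h_sub h_const
    rw [h_sub, Pi.sub_apply, ← expectation_apply]
    exact congrArg _ h_const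
  rw [covar, L2.inner_def]
  refine integral_congr_ae ?_
  filter_upwards [h_centred U, h_centred V] with ω hU hV
  rw [hU, hV, RCLike.inner_apply]

theorem continuous_covar : Continuous fun p : Lp ℂ 2 P × Lp ℂ 2 P ↦ covar p.1 p.2 := by
  simp only [covar_eq_inner_sub_const]
  fun_prop

end SecondMoments

section WhiteNoise

theorem inner_map_map_of_norm_map_eq {V E F : Type*} [AddCommGroup V] [Module ℂ V]
    [NormedAddCommGroup E] [InnerProductSpace ℂ E] [NormedAddCommGroup F] [InnerProductSpace ℂ F]
    {A : V →ₗ[ℂ] E} {B : V →ₗ[ℂ] F} (h : ∀ x, ‖A x‖ = ‖B x‖) (x y : V) :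
    inner ℂ (A x) (A y) = inner ℂ (B x) (B y) := by
  rw [inner_eq_sum_norm_sq_div_four, inner_eq_sum_norm_sq_div_four]
  simp only [← map_smul, ← map_add, ← map_sub, h]

theorem exists_eq_real_add_I_smul_real {E : Type*} [NormedAddCommGroup E] [NormedSpace ℝ E]
    (f : 𝓢(E, ℂ)) :
    ∃ u v : 𝓢(E, ℂ), (∀ x, (u x).im = 0) ∧ (∀ x, (v x).im = 0) ∧ f = u + Complex.I • v := by
  refine ⟨SchwartzMap.postcompCLM (𝕜 := ℝ) (Complex.ofRealCLM ∘L Complex.reCLM) f,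
    SchwartzMap.postcompCLM (𝕜 := ℝ) (Complex.ofRealCLM ∘L Complex.imCLM) f,
    fun _ ↦ by simp, fun _ ↦ by simp, ?_⟩
  ext x
  simp [Complex.ext_iff]

namespace IsGaussianWhiteNoise

variable {d : ℕ} {Ω : Type*} [MeasurableSpace Ω] {P : Measure Ω} {W : RandomField d P}
  {f : 𝓢(Space d, ℂ)}

theorem integral_eq_zero_of_real (hW : IsGaussianWhiteNoise W) (hf : ∀ x, (f x).im = 0) :
    ∫ ω, W f ω ∂P = 0 := by
  rw [(hW f hf).integral_eq, integral_map (by fun_prop) (by fun_prop), integral_complex_ofReal,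
    integral_id_gaussianReal, Complex.ofReal_zero]

theorem ae_im_eq_zero_of_real (hW : IsGaussianWhiteNoise W) (hf : ∀ x, (f x).im = 0) :
    ∀ᵐ ω ∂P, (W f ω).im = 0 := by
  have h_meas : MeasurableSet {z : ℂ | z.im = 0} :=
    measurableSet_eq_fun Complex.measurable_im measurable_const
  refine ((hW f hf).ae_iff (p := fun z : ℂ ↦ z.im = 0) (measurableSet_setOfPred.1 h_meas)).2 ?_
  rw [ae_map_iff (by fun_prop) h_meas]
  exact .of_forall Complex.ofReal_im

theorem integral_norm_sq_of_real (hW : IsGaussianWhiteNoise W) (hf : ∀ x, (f x).im = 0) :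
    ∫ ω, ‖W f ω‖ ^ 2 ∂P = ∫ x, ‖f x‖ ^ 2 := by
  have h_law := (hW f hf).integral_comp (f := fun z : ℂ ↦ ‖z‖ ^ 2) (by fun_prop)
  have h_var := variance_id_gaussianReal (μ := 0) (v := Real.toNNReal (∫ x, (f x).re ^ 2))
  rw [variance_of_integral_eq_zero (by fun_prop) (by simp),
    Real.coe_toNNReal _ (integral_nonneg fun _ ↦ sq_nonneg _)] at h_var
  have h_norm x : ‖f x‖ ^ 2 = (f x).re ^ 2 := by
    rw [Complex.sq_norm, Complex.normSq_apply, hf x]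
    ring
  simp only [h_norm]
  rw [← h_var]
  refine h_law.trans ?_
  rw [integral_map (by fun_prop) (by fun_prop)]
  simp only [Complex.norm_real, Real.norm_eq_abs, sq_abs, id]

theorem norm_eq_norm_toLp (hW : IsGaussianWhiteNoise W) (f : 𝓢(Space d, ℂ)) :
    ‖W f‖ = ‖SchwartzMap.toLpCLM ℂ ℂ 2 volume f‖ := by
  obtain ⟨u, v, hu, hv, rfl⟩ := exists_eq_real_add_I_smul_real f
  have h_real {g : 𝓢(Space d, ℂ)} (hg : ∀ x, (g x).im = 0) :
      ∀ᵐ x, (SchwartzMap.toLpCLM ℂ ℂ 2 volume g x).im = 0 := by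
    filter_upwards [g.coeFn_toLp 2 volume] with x hx
    rw [SchwartzMap.toLpCLM_apply, hx, hg]
  have h_norm {g : 𝓢(Space d, ℂ)} (hg : ∀ x, (g x).im = 0) :
      ‖W g‖ ^ 2 = ‖SchwartzMap.toLpCLM ℂ ℂ 2 volume g‖ ^ 2 := by
    rw [norm_sq_eq_integral_norm_sq, norm_sq_eq_integral_norm_sq, hW.integral_norm_sq_of_real hg]
    refine integral_congr_ae ?_
    filter_upwards [g.coeFn_toLp 2 volume] with x hx
    rw [SchwartzMap.toLpCLM_apply, hx]
  rw [← sq_eq_sq₀ (norm_nonneg _) (norm_nonneg _), map_add, map_smul, map_add, map_smul,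
    norm_add_I_smul_sq_of_real (hW.ae_im_eq_zero_of_real hu) (hW.ae_im_eq_zero_of_real hv),
    norm_add_I_smul_sq_of_real (h_real hu) (h_real hv), h_norm hu, h_norm hv]

theorem inner_eq_integral (hW : IsGaussianWhiteNoise W) (f g : 𝓢(Space d, ℂ)) :
    inner ℂ (W g) (W f) = ∫ x, f x * (starRingEnd ℂ) (g x) :=
  (inner_map_map_of_norm_map_eq (A := W.toLinearMap)
    (B := (SchwartzMap.toLpCLM ℂ ℂ 2 volume).toLinearMap) hW.norm_eq_norm_toLp g f).trans
    (SchwartzMap.inner_toL2_toL2_eq g f volume)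

variable [IsFiniteMeasure P]

theorem integral_eq_zero (hW : IsGaussianWhiteNoise W) (f : 𝓢(Space d, ℂ)) :
    ∫ ω, W f ω ∂P = 0 := by
  obtain ⟨u, v, hu, hv, rfl⟩ := exists_eq_real_add_I_smul_real f
  rw [← expectation_apply, map_add, map_smul, map_add, map_smul, expectation_apply,
    expectation_apply, hW.integral_eq_zero_of_real hu, hW.integral_eq_zero_of_real hv, smul_zero,
    add_zero]

theorem hasSpectralDensity (hW : IsGaussianWhiteNoise W) :
    HasSpectralDensity W fun _ ↦ ((2 * Real.pi) ^ d)⁻¹ := by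
  refine ⟨measurable_const, fun _ ↦ by positivity, ⟨0, fun f ↦ ?_⟩, fun f g ↦ ⟨?_, ?_⟩⟩
  · rw [hW.integral_eq_zero, zero_mul]
  · exact (integrable_angularTransform_mul_conj f g).mul_const _
  · rw [covar_eq_inner_of_integral_eq_zero (hW.integral_eq_zero f) (hW.integral_eq_zero g),
      hW.inner_eq_integral, integral_mul_const, integral_angularTransform_mul_conj]
    push_cast
    field_simp

end IsGaussianWhiteNoise

end WhiteNoise

section Mollifiers

open Filter Topology

theorem integrable_of_tendsto_of_tendsto_integral_norm {α E : Type*} [MeasurableSpace α]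
    {μ : Measure α} [NormedAddCommGroup E] {f : ℕ → α → E} {g : α → E} {c : ℝ}
    (hf : ∀ n, Integrable (f n) μ) (hfg : ∀ᵐ x ∂μ, Tendsto (fun n ↦ f n x) atTop (𝓝 (g x)))
    (hc : Tendsto (fun n ↦ ∫ x, ‖f n x‖ ∂μ) atTop (𝓝 c)) : Integrable g μ := by
  have h_meas n := (hf n).aestronglyMeasurable
  refine ⟨aestronglyMeasurable_of_tendsto_ae atTop h_meas hfg, ?_⟩
  calc ∫⁻ x, ‖g x‖ₑ ∂μ
    _ = ∫⁻ x, liminf (fun n ↦ ‖f n x‖ₑ) atTop ∂μ :=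
      lintegral_congr_ae (hfg.mono fun _ hx ↦ hx.enorm.liminf_eq.symm)
    _ ≤ liminf (fun n ↦ ∫⁻ x, ‖f n x‖ₑ ∂μ) atTop :=
      lintegral_liminf_le' fun n ↦ (h_meas n).enorm
    _ = ENNReal.ofReal c := by
      simp only [← ofReal_integral_norm_eq_lintegral_enorm (hf _)]
      exact (ENNReal.tendsto_ofReal hc).liminf_eq
    _ < ⊤ := ENNReal.ofReal_lt_top

/-- Bump functions at the origin with radii tending to zero. -/
def shrinkingBump (E : Type*) [Zero E] (n : ℕ) : ContDiffBump (0 : E) where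
  rIn := 1 / (n + 2)
  rOut := 1 / (n + 1)
  rIn_pos := by positivity
  rIn_lt_rOut := by gcongr; norm_num

variable {d : ℕ}

theorem hasCompactSupport_normed_shrinkingBump (n : ℕ) (s : Space d) :
    HasCompactSupport fun x ↦ ((shrinkingBump (Space d) n).normed volume (s - x) : ℂ) :=
  ((shrinkingBump _ n).hasCompactSupport_normed.comp_homeomorph (Homeomorph.subLeft s)).comp_left
    (g := Complex.ofReal) Complex.ofReal_zero

/-- An approximate identity centred at `s`, as a sequence of test functions. -/
def mollifier (n : ℕ) (s : Space d) : 𝓢(Space d, ℂ) :=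
  (hasCompactSupport_normed_shrinkingBump n s).toSchwartzMap <|
    Complex.ofRealCLM.contDiff.comp <|
      (shrinkingBump (Space d) n).contDiff_normed.comp (contDiff_const.sub contDiff_id)

theorem mollifier_apply (n : ℕ) (s x : Space d) :
    mollifier n s x = (shrinkingBump (Space d) n).normed volume (s - x) :=
  rfl

theorem hasCompactSupport_mollifier (n : ℕ) (s : Space d) :
    HasCompactSupport (mollifier n s : Space d → ℂ) :=
  hasCompactSupport_normed_shrinkingBump n s

theorem tendsto_integral_mollifier_smul {E : Type*} [NormedAddCommGroup E] [NormedSpace ℂ E]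
    [CompleteSpace E] {g : Space d → E} (hg : Continuous g) (s : Space d) :
    Tendsto (fun n ↦ ∫ x, mollifier n s x • g x) atTop (𝓝 (g s)) := by
  have h_convolution := ContDiffBump.convolution_tendsto_right_of_continuous
    (φ := shrinkingBump (Space d)) (μ := volume) tendsto_one_div_add_atTop_nhds_zero_nat hg s
  refine h_convolution.congr fun n ↦ ?_
  simp [convolution_eq_swap, mollifier_apply]

theorem norm_angularTransform_mollifier_le (n : ℕ) (s k : Space d) :
    ‖angularTransform (mollifier n s) k‖ ≤ 1 := by
  let bump := shrinkingBump (Space d) n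
  calc ‖angularTransform (mollifier n s) k‖
    _ ≤ ∫ x, ‖Complex.exp (Complex.I * (inner ℝ k x : ℝ)) * mollifier n s x‖ :=
      norm_integral_le_integral_norm _
    _ = ∫ x, bump.normed volume (s - x) := by
      refine integral_congr_ae (.of_forall fun x ↦ ?_)
      simp only [norm_mul, Complex.norm_exp_I_mul_ofReal, one_mul, mollifier_apply,
        Complex.norm_real, Real.norm_of_nonneg (bump.nonneg_normed _), bump]
    _ = 1 := by rw [integral_sub_left_eq_self (bump.normed volume), bump.integral_normed]

theorem tendsto_angularTransform_mollifier (s k : Space d) :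
    Tendsto (fun n ↦ angularTransform (mollifier n s) k) atTop
      (𝓝 (Complex.exp (Complex.I * (inner ℝ k s : ℝ)))) := by
  simp only [angularTransform, mul_comm (Complex.exp _)]
  exact tendsto_integral_mollifier_smul
    (g := fun x ↦ Complex.exp (Complex.I * (inner ℝ k x : ℝ))) (by fun_prop) s

end Mollifiers

section Pointwise

open Filter Topology

variable {d : ℕ} {S : Space d → ℝ}

/-- The integrand in the spectral formula for the covariance of the `n`-th mollified values, at `s`
and at `t`, of a field with spectral density `S`. -/
def mollifiedDensity (S : Space d → ℝ) (s t : Space d) (n : ℕ) (k : Space d) : ℂ :=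
  angularTransform (mollifier n s) k * (starRingEnd ℂ) (angularTransform (mollifier n t) k) * S k

theorem tendsto_mollifiedDensity (S : Space d → ℝ) (s t k : Space d) :
    Tendsto (fun n ↦ mollifiedDensity S s t n k) atTop
      (𝓝 (Complex.exp (Complex.I * (inner ℝ k (s - t) : ℝ)) * S k)) := by
  have h_exp : Complex.exp (Complex.I * (inner ℝ k (s - t) : ℝ)) =
      Complex.exp (Complex.I * (inner ℝ k s : ℝ)) *
        (starRingEnd ℂ) (Complex.exp (Complex.I * (inner ℝ k t : ℝ))) := by
    rw [← Complex.exp_conj, ← Complex.exp_add, inner_sub_right, map_mul, Complex.conj_I,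
      Complex.conj_ofReal]
    push_cast
    ring_nf
  rw [h_exp]
  exact ((tendsto_angularTransform_mollifier s k).mul
    ((Complex.continuous_conj.tendsto _).comp
      (tendsto_angularTransform_mollifier t k))).mul_const _

theorem norm_mollifiedDensity_le (hS : ∀ k, 0 ≤ S k) (s t : Space d) (n : ℕ) (k : Space d) :
    ‖mollifiedDensity S s t n k‖ ≤ S k := by
  rw [mollifiedDensity, norm_mul, norm_mul, RCLike.norm_conj, Complex.norm_real,
    Real.norm_of_nonneg (hS k)]
  exact mul_le_of_le_one_left (hS k) (mul_le_one₀ (norm_angularTransform_mollifier_le _ _ _)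
    (norm_nonneg _) (norm_angularTransform_mollifier_le _ _ _))

theorem norm_mollifiedDensity_self (hS : ∀ k, 0 ≤ S k) (s : Space d) (n : ℕ) (k : Space d) :
    (‖mollifiedDensity S s s n k‖ : ℂ) = mollifiedDensity S s s n k := by
  rw [mollifiedDensity, Complex.mul_conj', norm_mul, norm_pow, Complex.norm_real, Complex.norm_real,
    Real.norm_of_nonneg (hS k), norm_norm, Complex.ofReal_mul, Complex.ofReal_pow]

variable {Ω : Type*} [MeasurableSpace Ω] {P : Measure Ω} {X : RandomField d P}
  {Y : Space d → Lp ℂ 2 P}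

theorem IsRepresentedBy.tendsto_mollifier (hY : IsRepresentedBy X Y) (s : Space d) :
    Tendsto (fun n ↦ X (mollifier n s)) atTop (𝓝 (Y s)) :=
  (tendsto_integral_mollifier_smul hY.1 s).congr fun n ↦
    (hY.2 (mollifier n s) (hasCompactSupport_mollifier n s)).symm

namespace HasSpectralDensity

theorem integrable_mollifiedDensity (hX : HasSpectralDensity X S) (s t : Space d) (n : ℕ) :
    Integrable (mollifiedDensity S s t n) :=
  (hX.2.2.2 (mollifier n s) (mollifier n t)).1

theorem covar_mollifier (hX : HasSpectralDensity X S) (s t : Space d) (n : ℕ) :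
    covar (X (mollifier n s)) (X (mollifier n t)) = ∫ k, mollifiedDensity S s t n k :=
  (hX.2.2.2 (mollifier n s) (mollifier n t)).2

variable [IsFiniteMeasure P]

theorem tendsto_integral_mollifiedDensity (hX : HasSpectralDensity X S)
    (hY : IsRepresentedBy X Y) (s t : Space d) :
    Tendsto (fun n ↦ ∫ k, mollifiedDensity S s t n k) atTop (𝓝 (covar (Y s) (Y t))) :=
  ((continuous_covar.tendsto (Y s, Y t)).comp
    ((hY.tendsto_mollifier s).prodMk_nhds (hY.tendsto_mollifier t))).congr
    (hX.covar_mollifier s t)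

-- By Fatou's lemma: the mollified densities of the variance at `0` are nonnegative and tend to `S`.
theorem integrable (hX : HasSpectralDensity X S) (hY : IsRepresentedBy X Y) : Integrable S := by
  have h_integral_norm n :
      (∫ k, mollifiedDensity S 0 0 n k).re = ∫ k, ‖mollifiedDensity S 0 0 n k‖ := by
    rw [← Complex.ofReal_re (∫ k, ‖mollifiedDensity S 0 0 n k‖), ← integral_complex_ofReal]
    simp only [norm_mollifiedDensity_self hX.2.1]
  have h_tendsto k : Tendsto (fun n ↦ mollifiedDensity S 0 0 n k) atTop (𝓝 (S k : ℂ)) := by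
    simpa using tendsto_mollifiedDensity S 0 0 k
  have h_variance : Tendsto (fun n ↦ ∫ k, ‖mollifiedDensity S 0 0 n k‖) atTop
      (𝓝 (covar (Y 0) (Y 0)).re) :=
    ((Complex.continuous_re.tendsto _).comp
      (hX.tendsto_integral_mollifiedDensity hY 0 0)).congr h_integral_norm
  exact (integrable_of_tendsto_of_tendsto_integral_norm (hX.integrable_mollifiedDensity 0 0)
    (.of_forall h_tendsto) h_variance).re

theorem exists_integral_eq (hX : HasSpectralDensity X S) (hY : IsRepresentedBy X Y) :
    ∃ m : ℂ, ∀ s, ∫ ω, Y s ω ∂P = m := by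
  obtain ⟨m, hm⟩ := hX.2.2.1
  refine ⟨m, fun s ↦ ?_⟩
  have h_mass : Tendsto (fun n ↦ ∫ x, mollifier n s x) atTop (𝓝 1) := by
    simpa using tendsto_integral_mollifier_smul (continuous_const (y := (1 : ℂ))) s
  have h_mean : Tendsto (fun n ↦ ∫ ω, X (mollifier n s) ω ∂P) atTop (𝓝 (∫ ω, Y s ω ∂P)) := by
    simp only [← expectation_apply]
    exact ((expectation P).continuous.tendsto _).comp (hY.tendsto_mollifier s)
  simp only [hm] at h_mean
  simpa using tendsto_nhds_unique h_mean (h_mass.const_mul m)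

theorem hasPointwiseSpectralDensity (hX : HasSpectralDensity X S) (hY : IsRepresentedBy X Y) :
    HasPointwiseSpectralDensity Y S := by
  refine ⟨hX.integrable hY, hX.2.1, hX.exists_integral_eq hY, fun s t ↦ ?_⟩
  exact tendsto_nhds_unique (hX.tendsto_integral_mollifiedDensity hY s t)
    (tendsto_integral_of_dominated_convergence S
      (fun n ↦ (hX.integrable_mollifiedDensity s t n).aestronglyMeasurable) (hX.integrable hY)
      (fun n ↦ .of_forall (norm_mollifiedDensity_le hX.2.1 s t n))
      (.of_forall (tendsto_mollifiedDensity S s t)))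

end HasSpectralDensity

end Pointwise

theorem dotProduct_vecMulVec_mulVec_self {d : ℕ} (k B : Space d) :
    k.ofLp ⬝ᵥ (Matrix.vecMulVec B.ofLp B.ofLp).mulVec k.ofLp = inner ℝ k B ^ 2 := by
  rw [Matrix.vecMulVec_mulVec, EuclideanSpace.inner_eq_star_dotProduct]
  simp [dotProduct_comm, sq]

end NestedSPDE

end

theorem proposition1_general {Ω : Type*} [MeasurableSpace Ω] (P : Measure Ω) [IsFiniteMeasure P]
    (d n₁ n₂ : ℕ) (κ : Fin n₁ → ℝ) (hκ : ∀ i, κ i ≠ 0) (α : Fin n₁ → ℝ)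
    (b : Fin n₂ → ℝ) (B : Fin n₂ → NestedSPDE.Space d) (φ : ℂ)
    (W : NestedSPDE.RandomField d P) (S₀ : NestedSPDE.Space d → ℝ)
    (hW : NestedSPDE.HasSpectralDensity W S₀)
    (X : NestedSPDE.RandomField d P)
    (hX : NestedSPDE.fracOpL₁ d (Lp ℂ 2 P) κ α X = NestedSPDE.opL₂ (Lp ℂ 2 P) b B (φ • W))
    (S : NestedSPDE.Space d → ℝ)
    (hS : ∀ k : NestedSPDE.Space d,
      S k = ‖φ‖ ^ 2 * S₀ k *
        ((∏ j, (b j ^ 2 + k.ofLp ⬝ᵥ (Matrix.vecMulVec (B j).ofLp (B j).ofLp).mulVec k.ofLp)) /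
          ∏ i, (κ i ^ 2 + ‖k‖ ^ 2) ^ α i)) :
    NestedSPDE.HasSpectralDensity X S ∧
      ∀ Y : NestedSPDE.Space d → Lp ℂ 2 P, NestedSPDE.IsRepresentedBy X Y →
        NestedSPDE.HasPointwiseSpectralDensity Y S := by
  have h : NestedSPDE.HasSpectralDensity X S := by
    convert (hX ▸ (hW.const_smul φ).map_opL₂ b B).of_fracOpL₁ hκ using 2 with k
    simp only [hS, NestedSPDE.dotProduct_vecMulVec_mulVec_self]
    ring
  exact ⟨h, fun Y hY ↦ h.hasPointwiseSpectralDensity hY⟩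

theorem proposition1 {Ω : Type*} [MeasurableSpace Ω] (P : Measure Ω) [IsProbabilityMeasure P]
    (d n₁ n₂ : ℕ) (κ : Fin n₁ → ℝ) (hκ : ∀ i, 0 < κ i ^ 2) (α : Fin n₁ → ℕ)
    (b : Fin n₂ → ℝ) (B : Fin n₂ → NestedSPDE.Space d) (φ : ℝ)
    (W : NestedSPDE.RandomField d P) (hW : NestedSPDE.IsGaussianWhiteNoise W)
    (X : NestedSPDE.RandomField d P)
    (hX : NestedSPDE.opL₁ d (Lp ℂ 2 P) κ α X
      = NestedSPDE.opL₂ (Lp ℂ 2 P) b B ((φ : ℂ) • W))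
    (S : NestedSPDE.Space d → ℝ)
    (hS : ∀ k : NestedSPDE.Space d,
      S k = φ ^ 2 / (2 * Real.pi) ^ d *
        ((∏ j, (b j ^ 2 + k.ofLp ⬝ᵥ (Matrix.vecMulVec (B j).ofLp (B j).ofLp).mulVec k.ofLp)) /
          ∏ j, (κ j ^ 2 + ‖k‖ ^ 2) ^ α j)) :
    NestedSPDE.HasSpectralDensity X S ∧
      ∀ Y : NestedSPDE.Space d → Lp ℂ 2 P, NestedSPDE.IsRepresentedBy X Y →
        NestedSPDE.HasPointwiseSpectralDensity Y S :=
  proposition1_general P d n₁ n₂ κ (fun i ↦ sq_pos_iff.1 (hκ i)) (fun i ↦ α i) b B φ W _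
    hW.hasSpectralDensity X (by rwa [NestedSPDE.fracOpL₁_natCast]) S
    fun k ↦ by simp [hS k, div_eq_mul_inv]
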